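/- Let $\mathcal H:\mathbb S^2\to\mathbb R$ be a $C^1$ function and let $v\in\mathbb S^2$ be such that $\mathcal H(v)=\mathcal H(-v)=0$. Let $\Gamma\subset\mathbb R^3$ be a closed regular curve. Let $M$ be a compact $\mathcal H$-surface with boundary $\Gamma$; that is, $M$ is a compact surface with boundary together with a $C^2$ immersion $\psi:M\to\mathbb R^3$ and a Gauss map (unit normal field) $N:M\to\mathbb S^2$, such that $\psi|_{\partial M}$ is a diffeomorphism onto $\Gamma$ and the mean curvature $H_M$ of the immersion (half the trace of the shape operator $-dN$) satisfies $H_M(p)=\mathcal H(N_p)$ for all $p\in M$. Put $$\mu_1=\min\{\langle p,v\rangle : p\in\Gamma\},\qquad \mu_2=\max\{\langle p,v\rangle : p\in\Gamma\}.$$ Then $\psi(M)$ is contained in the slab $\{x\in\mathbb R^3:\ \mu_1\le\langle x,v\rangle\le\mu_2\}$. -/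

import Mathlib

open scoped Manifold ContDiff RealInnerProductSpace

/-- Euclidean space `ℝ³`. -/
abbrev E3 : Type := EuclideanSpace ℝ (Fin 3)

/-- The unit sphere `𝕊²` of `ℝ³`. -/
abbrev S2 : Type := Metric.sphere (0 : E3) 1

noncomputable section

section Surface

variable {M : Type*} [TopologicalSpace M] [ChartedSpace (EuclideanHalfSpace 2) M]

/-- The differential `df_p : T_pM → ℝ³` of a map `f : M → ℝ³` on a surface with boundary, where
`T_pM` is identified with `ℝ²` by the preferred chart at `p`. -/
def diffAt (f : M → E3) (p : M) : EuclideanSpace ℝ (Fin 2) →L[ℝ] E3 :=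
  mvfderiv (𝓡∂ 2) f p

/-- `ψ` is an immersion of class `C²`. -/
structure IsImmersedSurface (ψ : M → E3) : Prop where
  contMDiff : ContMDiff (𝓡∂ 2) 𝓘(ℝ, E3) 2 ψ
  injective : ∀ p, Function.Injective (diffAt ψ p)

/-- `N` is a Gauss map of `ψ`: a unit vector field of class `C¹` along `ψ`, normal to `ψ`. -/
structure IsGaussMap (ψ : M → E3) (N : M → S2) : Prop where
  contMDiff : ContMDiff (𝓡∂ 2) 𝓘(ℝ, E3) 1 (fun p => (N p : E3))
  normal : ∀ (p : M) (w : EuclideanSpace ℝ (Fin 2)), ⟪(N p : E3), diffAt ψ p w⟫ = 0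

/-- The matrix of the first fundamental form `I(w, z) = ⟨dψ w, dψ z⟩` at `p`. -/
def firstForm (ψ : M → E3) (p : M) : Matrix (Fin 2) (Fin 2) ℝ :=
  Matrix.of fun i j =>
    ⟪diffAt ψ p (EuclideanSpace.single i 1), diffAt ψ p (EuclideanSpace.single j 1)⟫

/-- The matrix of the second fundamental form `II(w, z) = -⟨dN w, dψ z⟩` at `p`. -/
def secondForm (ψ : M → E3) (N : M → S2) (p : M) : Matrix (Fin 2) (Fin 2) ℝ :=
  Matrix.of fun i j =>
    -⟪diffAt (fun q => (N q : E3)) p (EuclideanSpace.single i 1),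
      diffAt ψ p (EuclideanSpace.single j 1)⟫

/-- The mean curvature `H_M(p)`: half the trace of the second fundamental form with respect to the
first one, that is, half the trace of the shape operator `-dN`. (So the graph of `u` with
`N = (-Du, 1) / √(1 + |Du|²)` has `2 H_M = div (Du / √(1 + |Du|²))`, and the unit sphere has mean
curvature `1` for the inner normal.) -/
def meanCurvature (ψ : M → E3) (N : M → S2) (p : M) : ℝ :=
  (1 / 2) * ((firstForm ψ p)⁻¹ * secondForm ψ N p).trace

/-- The immersed surface `ψ : M → ℝ³` with Gauss map `N` is an `𝓗`-surface:
`H_M(p) = 𝓗(N_p)` at every `p`. -/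
structure IsHSurface (𝓗 : S2 → ℝ) (ψ : M → E3) (N : M → S2) : Prop where
  immersed : IsImmersedSurface ψ
  gauss : IsGaussMap ψ N
  meanCurvature_eq : ∀ p, meanCurvature ψ N p = 𝓗 (N p)

/-- `Γ` is the boundary of the immersed surface `ψ : M → ℝ³`: the map `ψ` carries `∂M` bijectively
onto `Γ`. (For a compact `M` and an immersion `ψ`, such a restriction `ψ|∂M` is an injective
immersion of a compact one-dimensional manifold, hence a diffeomorphism onto its image.) -/
def HasBoundaryCurve (ψ : M → E3) (Γ : Set E3) : Prop :=
  Set.BijOn ψ ((𝓡∂ 2).boundary M) Γ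

end Surface

/-- `Γ` is (the trace of) a closed regular curve in `ℝ³`. -/
def IsClosedCurve (Γ : Set E3) : Prop :=
  ∃ (γ : ℝ → E3) (T : ℝ), 0 < T ∧ ContDiff ℝ 1 γ ∧ Function.Periodic γ T ∧
    (∀ t, deriv γ t ≠ 0) ∧ Set.range γ = Γ

end

/-! Since `𝓗` vanishes at `±v`, planes orthogonal to `v` are `𝓗`-surfaces for either normal, and the
theorem is a maximum principle against them. At an interior maximum the height itself yields only `0
≤ 0`, so it is perturbed to `⟪y, v⟫ + ε * exp (l * ⟪y, w⟫)` with `w` a unit vector orthogonal to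
`v`.

If the height exceeded its boundary bound, then for small `ε` the perturbed height would be maximal
at an interior point. There its gradient `v + t w` equals `c n`, with `n` the unit normal, and its
Hessian is `l t` times the square of `⟪·, w⟫`. Tracing the second order condition over the tangent
plane gives `l t (1 - ⟪w, n⟫²) + 2 c H ≤ 0` (`IsLocalMax.mean_curvature_comparison`). But `n` is
within `O(t)` of `v` or `-v`, so `|H| = |𝓗 n| ≤ C t` (`exists_bound_of_contMDiff_sphere`), and a
large `l` makes the left side positive. -/

/-! ### Second order conditions at a maximum -/

open Filter Topology in
/-- The necessary second order condition at a local maximum of a function of one variable. -/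
theorem IsLocalMax.second_deriv_nonpos {u u' : ℝ → ℝ} {x d : ℝ} (hmax : IsLocalMax u x)
    (hu : ∀ᶠ t in 𝓝 x, HasDerivAt u (u' t) t) (hu' : HasDerivAt u' d x) : d ≤ 0 := by
  by_contra! hd
  have he : deriv u =ᶠ[𝓝 x] u' := hu.mono fun t ht => ht.deriv
  have hdd : deriv (deriv u) x = d := by rw [he.deriv_eq, hu'.deriv]
  -- If `d > 0`, then `x` is also a local minimum, so `u` is locally constant and `d = 0`.
  have hmin : IsLocalMin u x :=
    isLocalMin_of_deriv_deriv_pos (by rw [hdd]; exact hd) hmax.deriv_eq_zero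
      hu.self_of_nhds.continuousAt
  have hc : u =ᶠ[𝓝 x] fun _ => u x := by
    filter_upwards [hmax, hmin] with t h1 h2 using le_antisymm h1 h2
  have h0 : deriv u =ᶠ[𝓝 x] fun _ => 0 := by
    filter_upwards [hc.eventuallyEq_nhds] with t ht
    rw [ht.deriv_eq]; simp
  rw [h0.deriv_eq] at hdd
  simp at hdd
  exact hd.ne hdd

open Filter Topology in
/-- Second order condition for a parametrized hypersurface `f` with normal field `n` touching a
level set of `F` from inside. -/
theorem IsLocalMax.inner_hessian_nonpos {W V : Type*} [NormedAddCommGroup W] [NormedSpace ℝ W]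
    [NormedAddCommGroup V] [InnerProductSpace ℝ V] {f n : W → V} {x : W} {F : V → ℝ} {G : V → V}
    {G' : V →L[ℝ] V} {c : ℝ} (hmax : IsLocalMax (F ∘ f) x) (hf : ContDiffAt ℝ 2 f x)
    (hn : DifferentiableAt ℝ n x) (hnf : ∀ᶠ y in 𝓝 x, ∀ a, ⟪n y, fderiv ℝ f y a⟫ = 0)
    (hF : ∀ y, HasFDerivAt F (innerSL ℝ (G y)) y) (hG : HasFDerivAt G G' (f x))
    (hc : G (f x) = c • n x) (a : W) :
    ⟪G' (fderiv ℝ f x a), fderiv ℝ f x a⟫ - c * ⟪fderiv ℝ n x a, fderiv ℝ f x a⟫ ≤ 0 := by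
  set γ : ℝ → W := fun t => x + t • a with hγ
  have hγ0 : γ 0 = x := by simp [hγ]
  have hγd : ∀ t, HasDerivAt γ a t := fun t => by
    simpa [hγ] using ((hasDerivAt_id t).smul_const a).const_add x
  have hγc : Tendsto γ (𝓝 0) (𝓝 x) := by
    have := (hγd 0).continuousAt.tendsto; rwa [hγ0] at this
  have hfd : ∀ᶠ y in 𝓝 x, DifferentiableAt ℝ f y :=
    (hf.eventually (by simp)).mono fun y hy => hy.differentiableAt (by simp)
  have hdf : DifferentiableAt ℝ (fderiv ℝ f) x :=
    (hf.fderiv_right (m := 1) (by norm_num)).differentiableAt (by simp)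
  -- Subtracting `c • n` changes nothing, as `n` is normal to `f`, but makes the left factor vanish
  -- at `t = 0`; the second derivative of `f` then drops out of the product rule.
  have hu : ∀ᶠ t in 𝓝 (0 : ℝ), HasDerivAt (fun t => F (f (γ t)))
      ⟪G (f (γ t)) - c • n (γ t), fderiv ℝ f (γ t) a⟫ t := by
    filter_upwards [hγc.eventually hfd, hγc.eventually hnf] with t h1 h2
    have h3 := ((hF (f (γ t))).comp_hasDerivAt t (h1.hasFDerivAt.comp_hasDerivAt t (hγd t)))
    have h4 : ⟪G (f (γ t)) - c • n (γ t), fderiv ℝ f (γ t) a⟫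
        = ⟪G (f (γ t)), fderiv ℝ f (γ t) a⟫ := by
      rw [inner_sub_left, inner_smul_left, h2 a]; simp
    rw [h4]
    exact h3
  have hmax' : IsLocalMax (fun t => F (f (γ t))) 0 := by
    have : ∀ᶠ t in 𝓝 (0 : ℝ), (F ∘ f) (γ t) ≤ (F ∘ f) x := hγc.eventually hmax
    filter_upwards [this] with t ht
    simpa [hγ0] using ht
  have hfx : HasFDerivAt f (fderiv ℝ f x) (γ 0) := by
    rw [hγ0]; exact hfd.self_of_nhds.hasFDerivAt
  have hnx : HasFDerivAt n (fderiv ℝ n x) (γ 0) := by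
    rw [hγ0]; exact hn.hasFDerivAt
  have hdx : HasFDerivAt (fderiv ℝ f) (fderiv ℝ (fderiv ℝ f) x) (γ 0) := by
    rw [hγ0]; exact hdf.hasFDerivAt
  have hGx : HasFDerivAt G G' (f (γ 0)) := by rwa [hγ0]
  have hA : HasDerivAt (fun t => G (f (γ t)) - c • n (γ t))
      (G' (fderiv ℝ f x a) - c • fderiv ℝ n x a) 0 :=
    (hGx.comp_hasDerivAt 0 (hfx.comp_hasDerivAt 0 (hγd 0))).sub
      ((hnx.comp_hasDerivAt 0 (hγd 0)).const_smul c)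
  have hB : HasDerivAt (fun t => fderiv ℝ f (γ t) a) (fderiv ℝ (fderiv ℝ f) x a a) 0 :=
    (((ContinuousLinearMap.apply ℝ V a).hasFDerivAt).comp_hasDerivAt (0 : ℝ)
      (hdx.comp_hasDerivAt 0 (hγd 0)))
  have := hmax'.second_deriv_nonpos hu (hA.inner ℝ hB)
  simp only [hγ0, hc, sub_self, inner_zero_left, zero_add, inner_sub_left, inner_smul_left] at this
  simpa using this

/-! ### Linear algebra of the traced condition -/

/-- If the quadratic form of `B` is nonpositive, so is the trace of `B` with respect to a
positive definite matrix. -/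
theorem trace_inv_mul_nonpos {g B : Matrix (Fin 2) (Fin 2) ℝ} (hsymm : g 0 1 = g 1 0)
    (hg : 0 < g 0 0) (hdet : 0 < g.det)
    (hB : ∀ a : Fin 2 → ℝ, ∑ i, ∑ j, a i * a j * B i j ≤ 0) : (g⁻¹ * B).trace ≤ 0 := by
  have h1 := hB ![0, 1]
  have h2 := hB ![g 0 1, -g 0 0]
  have h3 := hB ![1, 0]
  simp [Fin.sum_univ_two] at h1 h2 h3
  have hd : g.det = g 0 0 * g 1 1 - g 0 1 * g 1 0 := Matrix.det_fin_two g
  have key : g 1 1 * B 0 0 - g 0 1 * (B 1 0 + B 0 1) + g 0 0 * B 1 1 ≤ 0 := by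
    -- The left side is `g.det * B 0 0` plus the quadratic form of `B` at `(g 0 1, -g 0 0)`.
    have : g 0 0 * (g 1 1 * B 0 0 - g 0 1 * (B 1 0 + B 0 1) + g 0 0 * B 1 1) ≤ 0 := by
      have h4 : g.det * B 0 0 ≤ 0 := mul_nonpos_of_nonneg_of_nonpos hdet.le h3
      rw [hd, ← hsymm] at h4
      nlinarith
    exact nonpos_of_mul_nonpos_right this hg
  rw [Matrix.inv_def, Matrix.smul_mul, Matrix.trace_smul, Ring.inverse_eq_inv', smul_eq_mul]
  refine mul_nonpos_of_nonneg_of_nonpos (inv_nonneg.2 hdet.le) ?_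
  rw [Matrix.adjugate_fin_two, Matrix.trace_fin_two]
  simp [Matrix.mul_apply, Fin.sum_univ_two]
  rw [← hsymm]
  linarith

/-- The trace of `a aᵀ` with respect to `g`, for `a = g α`. -/
theorem trace_inv_mul_vecMulVec {g : Matrix (Fin 2) (Fin 2) ℝ} (hdet : g.det ≠ 0)
    (α : Fin 2 → ℝ) :
    (g⁻¹ * Matrix.vecMulVec (g.mulVec α) (g.mulVec α)).trace = α ⬝ᵥ g.mulVec α := by
  rw [Matrix.mul_vecMulVec, Matrix.trace_vecMulVec, Matrix.mulVec_mulVec,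
    Matrix.nonsing_inv_mul g (isUnit_iff_ne_zero.2 hdet), Matrix.one_mulVec]

/-- The hyperplane orthogonal to a unit vector of `ℝ³` is the range of any injective linear map
from `ℝ²` into it. -/
theorem exists_apply_eq_of_inner_eq_zero {L : EuclideanSpace ℝ (Fin 2) →L[ℝ] E3} {n z : E3}
    (hL : Function.Injective L) (hn : ‖n‖ = 1) (hnL : ∀ a, ⟪n, L a⟫ = 0) (hz : ⟪n, z⟫ = 0) :
    ∃ a, L a = z := by
  have hle : LinearMap.range L.toLinearMap ≤ (ℝ ∙ n)ᗮ := by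
    rintro _ ⟨a, rfl⟩
    exact Submodule.mem_orthogonal_singleton_iff_inner_right.2 (hnL a)
  have hn0 : n ≠ 0 := by rintro rfl; simp at hn
  have : Fact (Module.finrank ℝ E3 = 2 + 1) := ⟨by simp⟩
  have heq := Submodule.eq_of_le_of_finrank_eq hle (by
    rw [LinearMap.finrank_range_of_inj hL, Submodule.finrank_orthogonal_span_singleton (n := 2) hn0]
    simp)
  have : z ∈ LinearMap.range L.toLinearMap := by
    rw [heq]; exact Submodule.mem_orthogonal_singleton_iff_inner_right.2 hz
  exact this

/-- Traced form of the second order condition at a point where the gradient of the comparison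
function is `c • n` and its Hessian is `μ` times the square of `⟪·, w⟫`. -/
theorem trace_condition {L D : EuclideanSpace ℝ (Fin 2) →L[ℝ] E3} {n w : E3} {μ c : ℝ}
    (hL : Function.Injective L) (hn : ‖n‖ = 1) (hw : ‖w‖ = 1) (hnL : ∀ a, ⟪n, L a⟫ = 0)
    (hQ : ∀ a, μ * ⟪w, L a⟫ ^ 2 - c * ⟪D a, L a⟫ ≤ 0) :
    μ * (1 - ⟪w, n⟫ ^ 2) + c * ((Matrix.of fun i j =>
        ⟪L (EuclideanSpace.single i 1), L (EuclideanSpace.single j 1)⟫ :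
          Matrix (Fin 2) (Fin 2) ℝ)⁻¹ * (Matrix.of fun i j =>
        -⟪D (EuclideanSpace.single i 1), L (EuclideanSpace.single j 1)⟫)).trace ≤ 0 := by
  set g : Matrix (Fin 2) (Fin 2) ℝ := Matrix.of fun i j =>
        ⟪L (EuclideanSpace.single i 1), L (EuclideanSpace.single j 1)⟫ with hg
  set B : Matrix (Fin 2) (Fin 2) ℝ := Matrix.of fun i j =>
        -⟪D (EuclideanSpace.single i 1), L (EuclideanSpace.single j 1)⟫ with hB
  have hdec : ∀ (T : EuclideanSpace ℝ (Fin 2) →L[ℝ] E3) (a : EuclideanSpace ℝ (Fin 2)),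
      T a = a 0 • T (EuclideanSpace.single 0 1) + a 1 • T (EuclideanSpace.single 1 1) := by
    intro T a
    rw [← map_smul, ← map_smul, ← map_add]
    congr 1
    ext i
    fin_cases i <;> simp
  set e₀ := L (EuclideanSpace.single 0 1) with he₀
  set e₁ := L (EuclideanSpace.single 1 1) with he₁
  have hsymm : g 0 1 = g 1 0 := by simp only [hg, Matrix.of_apply]; exact real_inner_comm _ _
  have hpos : 0 < g 0 0 := by
    simp only [hg, Matrix.of_apply]
    refine real_inner_self_pos.2 fun h => ?_
    have := hL (h.trans (map_zero L).symm)
    simp at this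
  have hdet : 0 < g.det := by
    -- The squared norm of this Gram–Schmidt vector is `⟪e₀, e₀⟫ * g.det`.
    have h : L (!₂[-⟪e₀, e₁⟫, ⟪e₀, e₀⟫]) ≠ 0 := by
      intro h
      have := congrArg (fun z : EuclideanSpace ℝ (Fin 2) => z 1) (hL (h.trans (map_zero L).symm))
      have h4 : ⟪e₀, e₀⟫ = 0 := by simpa using this
      exact hpos.ne' h4
    have h2 := real_inner_self_pos.2 h
    rw [hdec L] at h2
    simp only [← he₀, ← he₁, inner_add_left, inner_add_right, inner_smul_left, inner_smul_right,
      real_inner_comm e₀ e₁] at h2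
    have h3 : g.det = ⟪e₀, e₀⟫ * ⟪e₁, e₁⟫ - ⟪e₀, e₁⟫ * ⟪e₀, e₁⟫ := by
      rw [Matrix.det_fin_two, ← hsymm]; rfl
    rw [h3]
    have h4 : 0 < ⟪e₀, e₀⟫ := hpos
    simp only [Matrix.cons_val_zero, Matrix.cons_val_one, conj_trivial] at h2
    refine (mul_pos_iff_of_pos_left h4).1 ?_
    linarith
  -- `α` holds the coordinates of the tangential part of `w`, whose squared length is `1 - ⟪w, n⟫ ^
  -- 2`.
  obtain ⟨α, hα⟩ := exists_apply_eq_of_inner_eq_zero (z := w - ⟪w, n⟫ • n) hL hn hnL (by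
    rw [inner_sub_right, inner_smul_right, real_inner_self_eq_norm_sq, hn, real_inner_comm]; ring)
  have hwL : ∀ a, ⟪w, L a⟫ = ⟪L α, L a⟫ := by
    intro a; rw [hα, inner_sub_left, inner_smul_left, hnL]; simp
  have hgα : g.mulVec α = fun i => ⟪w, L (EuclideanSpace.single i 1)⟫ := by
    funext i
    rw [hwL, hdec L α, inner_add_left, inner_smul_left, inner_smul_left]
    simp only [Matrix.mulVec, dotProduct, Fin.sum_univ_two, hg, Matrix.of_apply, ← he₀, ← he₁]
    rw [real_inner_comm e₀, real_inner_comm e₁]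
    simp; ring
  have hnorm : α.ofLp ⬝ᵥ g.mulVec α = 1 - ⟪w, n⟫ ^ 2 := by
    have h1 : α.ofLp ⬝ᵥ g.mulVec α = ⟪w, L α⟫ := by
      rw [hgα, hdec L α, inner_add_right, inner_smul_right, inner_smul_right]
      simp [dotProduct, Fin.sum_univ_two, ← he₀, ← he₁]
    rw [h1, hα, inner_sub_right, inner_smul_right, real_inner_self_eq_norm_sq, hw]; ring
  have htr : (g⁻¹ * (μ • Matrix.vecMulVec (g.mulVec α) (g.mulVec α) + c • B)).trace ≤ 0 := by
    refine trace_inv_mul_nonpos hsymm hpos hdet fun a => ?_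
    have h := hQ (WithLp.toLp 2 a)
    rw [hdec L, hdec D] at h
    simp only [hgα, hB, Matrix.add_apply, Matrix.smul_apply, Matrix.vecMulVec_apply,
      Matrix.of_apply, Fin.sum_univ_two, smul_eq_mul, ← he₀, ← he₁]
    simp only [← he₀, ← he₁, inner_add_left, inner_add_right, inner_smul_left,
      inner_smul_right] at h
    simp only [conj_trivial] at h
    refine le_of_eq_of_le ?_ h
    ring
  rw [Matrix.mul_add, Matrix.trace_add, Matrix.mul_smul, Matrix.mul_smul, Matrix.trace_smul,
    Matrix.trace_smul, trace_inv_mul_vecMulVec hdet.ne',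
    hnorm] at htr
  simpa using htr

/-! ### Growth of `𝓗` near a zero -/

/-- A `C¹` function on the sphere vanishing at `v` grows at most linearly along a great circle
through `v`. -/
theorem exists_bound_of_contMDiff_sphere {𝓗 : S2 → ℝ} (h𝓗 : ContMDiff (𝓡 2) 𝓘(ℝ, ℝ) 1 𝓗)
    {v : S2} (hv : 𝓗 v = 0) {w : E3} (hw : ‖w‖ = 1) (hvw : ⟪(v : E3), w⟫ = 0) :
    ∃ C > 0, ∃ δ > 0, ∀ t : ℝ, |t| < δ → ∀ n : S2,
      (n : E3) = (√(1 + t ^ 2))⁻¹ • ((v : E3) + t • w) → |𝓗 n| ≤ C * |t| := by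
  have hpos : ∀ t : ℝ, 0 < 1 + t ^ 2 := fun t => by positivity
  have hv1 : ‖(v : E3)‖ = 1 := by simp
  have hnorm : ∀ t : ℝ, (√(1 + t ^ 2))⁻¹ • ((v : E3) + t • w) ∈ Metric.sphere (0 : E3) 1 := by
    intro t
    have h1 : ‖(v : E3) + t • w‖ = √(1 + t ^ 2) := by
      rw [eq_comm, Real.sqrt_eq_iff_mul_self_eq (hpos t).le (norm_nonneg _),
        norm_add_mul_self_real, norm_smul, hv1, hw, inner_smul_right, hvw]
      simp [sq]
    rw [mem_sphere_zero_iff_norm, norm_smul, h1, norm_inv, Real.norm_of_nonneg (Real.sqrt_nonneg _)]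
    exact inv_mul_cancel₀ (Real.sqrt_pos.2 (hpos t)).ne'
  have : Fact (Module.finrank ℝ E3 = 2 + 1) := ⟨by simp⟩
  have hsmooth : ContMDiff 𝓘(ℝ, ℝ) 𝓘(ℝ, E3) 1
      (fun t : ℝ => (√(1 + t ^ 2))⁻¹ • ((v : E3) + t • w)) := by
    refine ContDiff.contMDiff (ContDiff.smul (ContDiff.inv (ContDiff.sqrt ?_ ?_) ?_) ?_)
    · fun_prop
    · exact fun t => (hpos t).ne'
    · exact fun t => (Real.sqrt_pos.2 (hpos t)).ne'
    · fun_prop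
  have hcomp := (h𝓗.comp (hsmooth.codRestrict_sphere (n := 2) hnorm)).contDiff
  have hO := (hcomp.differentiable (by simp) 0).isBigO_sub
  obtain ⟨C, hC, hCO⟩ := hO.exists_pos
  obtain ⟨δ, hδ, hball⟩ := Metric.eventually_nhds_iff.1 hCO.bound
  refine ⟨C, hC, δ, hδ, fun t ht n hn => ?_⟩
  have h0 : (Set.codRestrict (fun t : ℝ => (√(1 + t ^ 2))⁻¹ • ((v : E3) + t • w))
      (Metric.sphere (0 : E3) 1) hnorm 0) = v := by
    ext1; simp
  have h1 : (Set.codRestrict (fun t : ℝ => (√(1 + t ^ 2))⁻¹ • ((v : E3) + t • w))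
      (Metric.sphere (0 : E3) 1) hnorm t) = n := by
    ext1; simp [hn]
  have := hball (y := t) (by simpa [Real.dist_eq] using ht)
  rw [Function.comp_apply, Function.comp_apply, h0, h1, hv] at this
  simpa using this

/-! ### Comparison at an interior point of the surface -/

section Surface

variable {M : Type*} [TopologicalSpace M] [ChartedSpace (EuclideanHalfSpace 2) M]

open Filter Topology

theorem diffAt_eq_fderiv {f : M → E3} {p : M} (hp : (𝓡∂ 2).IsInteriorPoint p)
    (hf : MDifferentiableAt (𝓡∂ 2) 𝓘(ℝ, E3) f p) :
    diffAt f p = fderiv ℝ (f ∘ (extChartAt (𝓡∂ 2) p).symm) (extChartAt (𝓡∂ 2) p p) := by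
  have h : diffAt f p = fderivWithin ℝ (f ∘ (extChartAt (𝓡∂ 2) p).symm) (Set.range (𝓡∂ 2))
      (extChartAt (𝓡∂ 2) p p) := by
    unfold diffAt
    rw [hf.mvfderiv]
    rfl
  rw [h, fderivWithin_of_mem_nhds (mem_interior_iff_mem_nhds.1 hp)]

theorem extChartAt_target_mem_nhds_of_isInteriorPoint {p : M}
    (hp : (𝓡∂ 2).IsInteriorPoint p) :
    (extChartAt (𝓡∂ 2) p).target ∈ 𝓝 (extChartAt (𝓡∂ 2) p p) := by
  have := extChartAt_target_mem_nhdsWithin (I := 𝓡∂ 2) p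
  rwa [nhdsWithin_eq_nhds.2 (mem_interior_iff_mem_nhds.1 hp)] at this

theorem ContMDiffAt.contDiffAt_comp_extChartAt_symm {k : WithTop ℕ∞} {f : M → E3} {p : M}
    (hp : (𝓡∂ 2).IsInteriorPoint p) (hf : ContMDiffAt (𝓡∂ 2) 𝓘(ℝ, E3) k f p) :
    ContDiffAt ℝ k (f ∘ (extChartAt (𝓡∂ 2) p).symm) (extChartAt (𝓡∂ 2) p p) := by
  have h := (contMDiffAt_iff.1 hf).2
  exact ContDiffWithinAt.contDiffAt h (mem_interior_iff_mem_nhds.1 hp)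

/-- In a chart around an interior point, the differential of the chart expression of `f` takes
values in the range of the differential of `f`. -/
theorem eventually_exists_fderiv_eq_diffAt [IsManifold (𝓡∂ 2) 2 M] {f : M → E3} {p : M}
    (hp : (𝓡∂ 2).IsInteriorPoint p) (hf : MDifferentiable (𝓡∂ 2) 𝓘(ℝ, E3) f) :
    ∀ᶠ y in 𝓝 (extChartAt (𝓡∂ 2) p p), ∀ a, ∃ b,
      fderiv ℝ (f ∘ (extChartAt (𝓡∂ 2) p).symm) y a
        = diffAt f ((extChartAt (𝓡∂ 2) p).symm y) b := by
  have : IsManifold (𝓡∂ 2) 1 M := IsManifold.of_le (n := 2) (by norm_num)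
  filter_upwards [extChartAt_target_mem_nhds_of_isInteriorPoint hp,
    isOpen_interior.mem_nhds hp] with y hy hyr a
  have hyn : Set.range (𝓡∂ 2) ∈ 𝓝 y := mem_interior_iff_mem_nhds.1 hyr
  have h1 := (mdifferentiableWithinAt_extChartAt_symm (I := 𝓡∂ 2) hy).mdifferentiableAt hyn
  have h2 := mfderiv_comp y (hf _) h1
  refine ⟨mfderiv 𝓘(ℝ, EuclideanSpace ℝ (Fin 2)) (𝓡∂ 2) (extChartAt (𝓡∂ 2) p).symm y a, ?_⟩
  rw [mfderiv_eq_fderiv] at h2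
  rw [h2]
  rfl

/-- Comparison at an interior point where `F ∘ ψ` has a local maximum. -/
theorem IsLocalMax.mean_curvature_comparison [IsManifold (𝓡∂ 2) 2 M] {ψ : M → E3} {N : M → S2}
    (hψ : IsImmersedSurface ψ) (hN : IsGaussMap ψ N) {p : M} (hp : (𝓡∂ 2).IsInteriorPoint p)
    {F : E3 → ℝ} {G : E3 → E3} {μ : ℝ} {w : E3} (hw : ‖w‖ = 1)
    (hmax : IsLocalMax (F ∘ ψ) p) (hF : ∀ y, HasFDerivAt F (innerSL ℝ (G y)) y)
    (hG : HasFDerivAt G (μ • (innerSL ℝ w).smulRight w) (ψ p)) :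
    ∃ c : ℝ, G (ψ p) = c • (N p : E3) ∧
      μ * (1 - ⟪w, (N p : E3)⟫ ^ 2) + 2 * c * meanCurvature ψ N p ≤ 0 := by
  set x := extChartAt (𝓡∂ 2) p p with hx
  set f := ψ ∘ (extChartAt (𝓡∂ 2) p).symm with hf
  set n := (fun q => (N q : E3)) ∘ (extChartAt (𝓡∂ 2) p).symm with hn
  have hfx : f x = ψ p := congrArg ψ (extChartAt_to_inv p)
  have hnx : n x = N p := congrArg (fun q => (N q : E3)) (extChartAt_to_inv p)
  have hψd : MDifferentiable (𝓡∂ 2) 𝓘(ℝ, E3) ψ := hψ.contMDiff.mdifferentiable (by simp)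
  have hNd := hN.contMDiff.mdifferentiable (by simp)
  have hL : diffAt ψ p = fderiv ℝ f x := diffAt_eq_fderiv hp (hψd p)
  have hD : diffAt (fun q => (N q : E3)) p = fderiv ℝ n x := diffAt_eq_fderiv hp (hNd p)
  have hfc : ContDiffAt ℝ 2 f x := hψ.contMDiff.contMDiffAt.contDiffAt_comp_extChartAt_symm hp
  have hnc : ContDiffAt ℝ 1 n x := hN.contMDiff.contMDiffAt.contDiffAt_comp_extChartAt_symm hp
  have hnf : ∀ᶠ y in 𝓝 x, ∀ a, ⟪n y, fderiv ℝ f y a⟫ = 0 := by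
    filter_upwards [eventually_exists_fderiv_eq_diffAt hp hψd] with y hy a
    obtain ⟨b, hb⟩ := hy a
    rw [hb]
    exact hN.normal _ b
  have hmaxx : IsLocalMax (F ∘ f) x := by
    have hc : Tendsto (extChartAt (𝓡∂ 2) p).symm (𝓝 x) (𝓝 p) := by
      have := continuousAt_extChartAt_symm (I := 𝓡∂ 2) p
      rwa [ContinuousAt, extChartAt_to_inv] at this
    filter_upwards [hc.eventually hmax] with y hy
    rw [Function.comp_apply (x := x), hfx]
    exact hy
  have hN1 : ‖(N p : E3)‖ = 1 := by simp
  have hnL : ∀ a, ⟪(N p : E3), fderiv ℝ f x a⟫ = 0 := by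
    intro a; rw [← hL]; exact hN.normal p a
  have hinj : Function.Injective (fderiv ℝ f x) := by rw [← hL]; exact hψ.injective p
  have hcrit : ∀ a, ⟪G (ψ p), fderiv ℝ f x a⟫ = 0 := by
    intro a
    have h1 := (hF (f x)).comp x (hfc.differentiableAt (by simp)).hasFDerivAt
    have h2 := hmaxx.hasFDerivAt_eq_zero h1
    have := DFunLike.congr_fun h2 a
    simpa [hfx] using this
  obtain ⟨b, hb⟩ := exists_apply_eq_of_inner_eq_zero
    (z := G (ψ p) - ⟪G (ψ p), (N p : E3)⟫ • (N p : E3)) hinj hN1 hnL (by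
    rw [inner_sub_right, inner_smul_right, real_inner_self_eq_norm_sq, hN1, real_inner_comm]; ring)
  -- The tangential part of the gradient is orthogonal to every tangent vector, hence to itself.
  have hGN : G (ψ p) = ⟪G (ψ p), (N p : E3)⟫ • (N p : E3) := by
    rw [← sub_eq_zero, ← inner_self_eq_zero (𝕜 := ℝ)]
    nth_rewrite 2 [← hb]
    rw [inner_sub_left, inner_smul_left, hcrit, hnL]
    simp
  refine ⟨_, hGN, ?_⟩
  set c := ⟪G (ψ p), (N p : E3)⟫
  have hQ := hmaxx.inner_hessian_nonpos (c := c) hfc (hnc.differentiableAt (by simp)) hnf hF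
    (by rw [hfx]; exact hG) (by rw [hfx, hnx]; exact hGN)
  have key := trace_condition (D := fderiv ℝ n x) (c := c) (μ := μ) hinj hN1 hw hnL (by
    intro a
    have := hQ a
    simp only [smul_apply, ContinuousLinearMap.smulRight_apply,
      innerSL_apply_apply, inner_smul_left, conj_trivial] at this
    refine le_of_eq_of_le ?_ this
    ring)
  rw [← hL, ← hD] at key
  refine le_of_eq_of_le ?_ key
  unfold meanCurvature firstForm secondForm
  ring

end Surface

/-! ### The perturbed height -/

section Comparison

variable (v w : E3) (ε l : ℝ)

/-- The comparison function: a perturbation of the height in direction `v` by an exponential in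
an orthogonal direction `w`. -/
noncomputable def perturbedHeight (y : E3) : ℝ := ⟪y, v⟫ + ε * Real.exp (l * ⟪y, w⟫)

/-- The slope in the direction `w` of `perturbedHeight`. -/
noncomputable def perturbationSlope (y : E3) : ℝ := ε * l * Real.exp (l * ⟪y, w⟫)

theorem hasFDerivAt_inner_left_const (y : E3) :
    HasFDerivAt (fun y : E3 => ⟪y, w⟫) (innerSL ℝ w) y := by
  have h : (fun y : E3 => ⟪y, w⟫) = innerSL ℝ w := by
    funext y; exact real_inner_comm _ _
  rw [h]
  exact (innerSL ℝ w).hasFDerivAt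

theorem hasFDerivAt_perturbedHeight (y : E3) :
    HasFDerivAt (perturbedHeight v w ε l)
      (innerSL ℝ (v + perturbationSlope w ε l y • w)) y := by
  have h := (hasFDerivAt_inner_left_const v y).add
    ((((hasFDerivAt_inner_left_const w y).const_mul l).exp).const_mul ε)
  convert! h using 1
  ext z
  simp [perturbationSlope]
  ring

/-- The exponential is chosen for this: the Hessian is `l` times the slope, independently of `ε` and
`y`, so it can dominate any fixed multiple of the slope. -/
theorem hasFDerivAt_gradient_perturbedHeight (y : E3) :
    HasFDerivAt (fun y => v + perturbationSlope w ε l y • w)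
      ((l * perturbationSlope w ε l y) • (innerSL ℝ w).smulRight w) y := by
  have h := (((((hasFDerivAt_inner_left_const w y).const_mul l).exp).const_mul
    (ε * l)).smul_const w).const_add v
  convert! h using 1
  ext z
  simp [perturbationSlope]
  ring

end Comparison

/-- Unit vectors `n` proportional to `v + t w`, for orthonormal `v` and `w`. -/
theorem eq_or_eq_of_add_smul_eq_smul {v w n : E3} {t c : ℝ} (hv : ‖v‖ = 1) (hw : ‖w‖ = 1)
    (hn : ‖n‖ = 1) (hvw : ⟪v, w⟫ = 0) (h : v + t • w = c • n) :
    ⟪w, n⟫ ^ 2 = t ^ 2 / (1 + t ^ 2) ∧ |c| = √(1 + t ^ 2) ∧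
      (n = (√(1 + t ^ 2))⁻¹ • (v + t • w) ∨ n = (√(1 + t ^ 2))⁻¹ • (-v + (-t) • w)) := by
  have hpos : 0 < 1 + t ^ 2 := by positivity
  have hs : √(1 + t ^ 2) ≠ 0 := (Real.sqrt_pos.2 hpos).ne'
  have hc2 : c ^ 2 = 1 + t ^ 2 := by
    have h1 : ⟪v + t • w, v + t • w⟫ = ⟪c • n, c • n⟫ := by rw [h]
    simp only [inner_add_left, inner_add_right, inner_smul_left, inner_smul_right,
      real_inner_comm v w, hvw, real_inner_self_eq_norm_sq, hv, hw, hn, conj_trivial] at h1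
    linarith
  have habs : |c| = √(1 + t ^ 2) := by rw [← hc2, Real.sqrt_sq_eq_abs]
  have hwn : c * ⟪w, n⟫ = t := by
    have h1 : ⟪w, v + t • w⟫ = ⟪w, c • n⟫ := by rw [h]
    simp only [inner_add_right, inner_smul_right, real_inner_comm v w, hvw,
      real_inner_self_eq_norm_sq, hw] at h1
    linarith
  refine ⟨?_, habs, ?_⟩
  · rw [eq_div_iff hpos.ne', ← hc2, ← hwn]; ring
  · rcases abs_choice c with hc | hc
    · left
      rw [h, ← habs, hc, smul_smul, inv_mul_cancel₀ (by rw [← hc, habs]; exact hs), one_smul]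
    · right
      have : -v + (-t) • w = (-c) • n := by rw [neg_smul c, ← h]; module
      rw [this, ← habs, hc, smul_smul, inv_mul_cancel₀ (by rw [← hc, habs]; exact hs), one_smul]

theorem exists_unit_orthogonal (v : E3) (hv : v ≠ 0) : ∃ w : E3, ‖w‖ = 1 ∧ ⟪v, w⟫ = 0 := by
  have : Fact (Module.finrank ℝ E3 = 2 + 1) := ⟨by simp⟩
  have h : 0 < Module.finrank ℝ (ℝ ∙ v)ᗮ := by
    rw [Submodule.finrank_orthogonal_span_singleton (n := 2) hv]; simp
  have := Module.finrank_pos_iff.1 h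
  obtain ⟨z, hz⟩ := exists_norm_eq ((ℝ ∙ v)ᗮ) (zero_le_one' ℝ)
  exact ⟨z, by simpa using hz, Submodule.mem_orthogonal_singleton_iff_inner_right.1 z.2⟩

/-! ### The maximum principle and the slab -/

/-- The height of a compact `𝓗`-surface in a direction `v` with `𝓗 v = 𝓗 (-v) = 0` is bounded by
its boundary values. -/
theorem IsHSurface.inner_le_of_boundary {𝓗 : S2 → ℝ} (h𝓗 : ContMDiff (𝓡 2) 𝓘(ℝ, ℝ) 1 𝓗)
    {v : S2} (hv : 𝓗 v = 0) (hnv : 𝓗 (-v) = 0)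
    {M : Type*} [TopologicalSpace M] [CompactSpace M]
    [ChartedSpace (EuclideanHalfSpace 2) M] [IsManifold (𝓡∂ 2) 2 M]
    {ψ : M → E3} {N : M → S2} (hM : IsHSurface 𝓗 ψ N) {m : ℝ}
    (hm : ∀ q ∈ (𝓡∂ 2).boundary M, ⟪ψ q, (v : E3)⟫ ≤ m) (p₀ : M) : ⟪ψ p₀, (v : E3)⟫ ≤ m := by
  by_contra! hp₀
  have hv1 : ‖(v : E3)‖ = 1 := by simp
  obtain ⟨w, hw, hvw⟩ := exists_unit_orthogonal (v : E3) (by rintro h; simp [h] at hv1)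
  obtain ⟨C₁, hC₁, δ₁, hδ₁, hb₁⟩ := exists_bound_of_contMDiff_sphere h𝓗 hv hw hvw
  obtain ⟨C₂, hC₂, δ₂, hδ₂, hb₂⟩ := exists_bound_of_contMDiff_sphere h𝓗 hnv hw
    (by simpa using hvw)
  set C := max C₁ C₂
  have hCpos : 0 < C := lt_max_of_lt_left hC₁
  have hψc : Continuous ψ := hM.immersed.contMDiff.continuous
  obtain ⟨S, hS⟩ := isCompact_univ.exists_bound_of_continuousOn
    (f := fun p => ⟪ψ p, w⟫) (hψc.inner continuous_const).continuousOn
  -- The curvature term will be at least `-4 C t` and the Hessian term at least `l t / 2`, so any `l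
  -- > 8 C` suffices.
  set l := 8 * C + 1 with hl
  have hlpos : 0 < l := by positivity
  have hexp : ∀ p, Real.exp (l * ⟪ψ p, w⟫) ≤ Real.exp (l * S) := fun p => by
    have := (le_abs_self _).trans (hS p trivial)
    gcongr
  -- The factor `1 + l` controls both the perturbation and its slope `t`. The gap to `m` keeps the
  -- maximum off the boundary, `1` gives `t ^ 2 ≤ 1`, and the `δ`s allow the linear bounds on `𝓗`.
  obtain ⟨ε, hε, hε'⟩ : ∃ ε > 0, ε * (Real.exp (l * S) * (1 + l)) <
      min (⟪ψ p₀, (v : E3)⟫ - m) (min 1 (min δ₁ δ₂)) := by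
    obtain ⟨ε, h1, h2⟩ := exists_pos_mul_lt
      (lt_min (sub_pos.2 hp₀) (lt_min one_pos (lt_min hδ₁ hδ₂))) (Real.exp (l * S) * (1 + l))
    exact ⟨ε, h1, by rwa [mul_comm]⟩
  simp only [lt_min_iff] at hε'
  obtain ⟨hεm, hε1, hεδ₁, hεδ₂⟩ := hε'
  have hcont : Continuous (perturbedHeight (v : E3) w ε l ∘ ψ) := by
    unfold perturbedHeight
    fun_prop
  obtain ⟨p, -, hp⟩ := isCompact_univ.exists_isMaxOn ⟨p₀, trivial⟩ hcont.continuousOn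
  have hmax : ∀ q, perturbedHeight (v : E3) w ε l (ψ q) ≤ perturbedHeight (v : E3) w ε l (ψ p) :=
    fun q => hp (Set.mem_univ q)
  have hEpos := Real.exp_pos (l * S)
  have hint : (𝓡∂ 2).IsInteriorPoint p := by
    by_contra hnot
    have hbd : p ∈ (𝓡∂ 2).boundary M := by
      rw [← ModelWithCorners.compl_interior]; exact hnot
    have h1 := hm p hbd
    have h2 := hmax p₀
    unfold perturbedHeight at h2
    have h3 := mul_le_mul_of_nonneg_left (hexp p) hε.le
    have h4 : 0 < ε * Real.exp (l * ⟪ψ p₀, w⟫) := by positivity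
    have h5 : 0 < ε * Real.exp (l * S) * l := by positivity
    linarith
  obtain ⟨c, hc, hineq⟩ := IsLocalMax.mean_curvature_comparison hM.immersed hM.gauss hint hw
    (F := perturbedHeight (v : E3) w ε l) (Filter.Eventually.of_forall hmax)
    (hasFDerivAt_perturbedHeight (v : E3) w ε l) (hasFDerivAt_gradient_perturbedHeight _ w ε l _)
  set t := perturbationSlope w ε l (ψ p) with ht
  have htpos : 0 < t := by rw [ht]; unfold perturbationSlope; positivity
  have htle : t ≤ ε * (Real.exp (l * S) * (1 + l)) := by
    have h3 := mul_le_mul_of_nonneg_left (hexp p) (mul_pos hε hlpos).le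
    have h5 : 0 < ε * Real.exp (l * S) := by positivity
    rw [ht]; unfold perturbationSlope
    linarith
  obtain ⟨hwn, hcabs, hN⟩ := eq_or_eq_of_add_smul_eq_smul hv1 hw (by simp) hvw hc
  have hH : |𝓗 (N p)| ≤ C * t := by
    -- The normal may point near `v` or near `-v`; hence zeros of `𝓗` are needed at both.
    rcases hN with hN | hN
    · have := hb₁ t (by rw [abs_of_pos htpos]; linarith) (N p) hN
      rw [abs_of_pos htpos] at this
      exact this.trans (by gcongr; exact le_max_left _ _)
    · have := hb₂ (-t) (by rw [abs_neg, abs_of_pos htpos]; linarith) (N p)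
        (by rw [neg_sq]; simpa using hN)
      rw [abs_neg, abs_of_pos htpos] at this
      exact this.trans (by gcongr; exact le_max_right _ _)
  rw [hM.meanCurvature_eq, hwn] at hineq
  have ht2 : t ^ 2 ≤ 1 := by nlinarith
  have hsq : √(1 + t ^ 2) ≤ 2 := Real.sqrt_le_iff.2 ⟨by norm_num, by linarith⟩
  have hcH : |c * 𝓗 (N p)| ≤ 2 * (C * t) := by
    rw [abs_mul, hcabs]
    gcongr
  have h1 : 1 / 2 ≤ 1 - t ^ 2 / (1 + t ^ 2) := by
    have : t ^ 2 / (1 + t ^ 2) ≤ 1 / 2 := by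
      rw [div_le_div_iff₀ (by positivity) (by norm_num)]; linarith
    linarith
  have h2 : l * t * (1 / 2) ≤ l * t * (1 - t ^ 2 / (1 + t ^ 2)) := by gcongr
  have h3 := neg_abs_le (c * 𝓗 (N p))
  have h4 : l * t * (1 / 2) = 4 * (C * t) + t / 2 := by rw [hl]; ring
  linarith

theorem IsClosedCurve.isCompact {Γ : Set E3} (hΓ : IsClosedCurve Γ) : IsCompact Γ := by
  obtain ⟨γ, T, hT, hγ, hper, -, rfl⟩ := hΓ
  rw [← hper.image_Icc hT 0]
  exact isCompact_Icc.image hγ.continuous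

theorem IsClosedCurve.nonempty {Γ : Set E3} (hΓ : IsClosedCurve Γ) : Γ.Nonempty := by
  obtain ⟨γ, T, -, -, -, -, rfl⟩ := hΓ
  exact Set.range_nonempty γ

theorem proposition2p7 (𝓗 : S2 → ℝ) (h𝓗 : ContMDiff (𝓡 2) 𝓘(ℝ, ℝ) 1 𝓗)
    (v : S2) (hv : 𝓗 v = 0) (hnv : 𝓗 (-v) = 0)
    (Γ : Set E3) (hΓ : IsClosedCurve Γ)
    (M : Type*) [TopologicalSpace M] [T2Space M] [CompactSpace M]
    [ChartedSpace (EuclideanHalfSpace 2) M] [IsManifold (𝓡∂ 2) 2 M]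
    (ψ : M → E3) (N : M → S2) (hM : IsHSurface 𝓗 ψ N) (hbd : HasBoundaryCurve ψ Γ) :
    ∃ μ₁ μ₂ : ℝ,
      IsLeast ((fun p : E3 => ⟪p, (v : E3)⟫) '' Γ) μ₁ ∧
      IsGreatest ((fun p : E3 => ⟪p, (v : E3)⟫) '' Γ) μ₂ ∧
      Set.range ψ ⊆ {x : E3 | μ₁ ≤ ⟪x, (v : E3)⟫ ∧ ⟪x, (v : E3)⟫ ≤ μ₂} := by
  have hc : IsCompact ((fun p : E3 => ⟪p, (v : E3)⟫) '' Γ) :=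
    hΓ.isCompact.image (by fun_prop)
  obtain ⟨μ₁, h₁⟩ := hc.exists_isLeast (hΓ.nonempty.image _)
  obtain ⟨μ₂, h₂⟩ := hc.exists_isGreatest (hΓ.nonempty.image _)
  refine ⟨μ₁, μ₂, h₁, h₂, ?_⟩
  rintro _ ⟨p, rfl⟩
  constructor
  -- The hypotheses are symmetric in `±v`, so the lower bound is the upper bound for the height
  -- along `-v`, with the same Gauss map.
  · have := hM.inner_le_of_boundary h𝓗 (v := -v) (m := -μ₁) hnv (by rwa [neg_neg])
      (fun q hq => by
        have := h₁.2 ⟨ψ q, hbd.mapsTo hq, rfl⟩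
        simpa using this) p
    simpa using this
  · exact hM.inner_le_of_boundary h𝓗 hv hnv (fun q hq => h₂.2 ⟨ψ q, hbd.mapsTo hq, rfl⟩) p
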